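/- Let $K, W \ge 0$ be integers. For $k=1,\dots,K$ let bandit $k$ have a finite set $N_k$ of states (the sets $N_k$ are disjoint, $N=\bigcup_k N_k$), a transition rate matrix $q^k\in\mathbb{R}^{N_k\times N_k}$, and, for each type $w\in\{0,1,\dots,W\}$ and each $i\in N_k$, a real type-$w$ reward $r_w(i)$ for playing bandit $k$ while its state is $i$. Assume Hypothesis RN: for each $k$, the matrix $q^k$ is nonnegative, transient (each entry of $(q^k)^t$ tends to $0$ as $t\to\infty$) and substochastic (nonnegative, with each row sum at most $1$). A multi-state $s=(s_1,\dots,s_K)$ consists of one state $s_k\in N_k$ for each $k$; let $S$ be the set of multi-states. A stationary deterministic policy is a map $\delta:S\to\{1,\dots,K\}$. For multi-states $s,t$ and $k=\delta(s)$, let $Q^\delta(s,t)=q^k(s_k,t_k)$ if $t_l=s_l$ for all $l\neq k$, and $Q^\delta(s,t)=0$ otherwise, and let $R_w^\delta(s)=r_w(s_k)$. The expected total type-$w$ reward of $\delta$ is the vector $V_w^\delta=(I-Q^\delta)^{-1}R_w^\delta$ (Hypothesis RN implies that $I-Q^\delta$ is invertible). A labeling is an injective map $L:N\cup\{0\}\to\{1,\dots,|N|+1\}$,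 where $0\notin N$ is the termination state, with $L(0)=|N|+1$. A priority rule is a stationary deterministic policy $\pi$ for which there is a labeling $L$ such that, for every $s\in S$, $\pi(s)$ is the index $k$ that minimizes $L(s_k)$. Fix an initial multi-state $s\in S$ and real numbers $C_1,\dots,C_W$. For a set $D$ of stationary deterministic policies consider the linear program: maximize $\sum_{\delta\in D}\alpha^\delta V_0^\delta(s)$ subject to $$\sum_{\delta\in D}\alpha^\delta=1,\qquad \sum_{\delta\in D}\alpha^\delta V_w^\delta(s)\ge C_w\quad(w=1,\dots,W),\qquad \alpha^\delta\ge 0\quad(\delta\in D).$$ Program 1 is this program with $D$ the set of all stationary deterministic policies; Program 2 is this program with $D$ the set of all priority rules. If Program 1 is feasible (its constraints have a solution), then Program 2 is also feasible. -/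

import Mathlib

namespace ConstrainedBandit

/-- The data of a multi-armed bandit with `K` bandits, bandit `k` having state set `N k`
(the state sets are disjoint: a state of some bandit is an element of `Σ k, N k`), and with
`W + 1` types of reward: type `0` is the objective, types `1, …, W` are constrained.
`q k i j` is the transition rate of bandit `k` from `i` to `j`, and `r w k i` is the
(expected, immediate) type-`w` reward for playing bandit `k` while its state is `i`. -/
structure MultiArmedBandit (K W : ℕ) (N : Fin K → Type*) where
  q : ∀ k, Matrix (N k) (N k) ℝ
  r : Fin (W + 1) → ∀ k, N k → ℝ

/-- A square matrix `Q` is transient if each entry of `Q ^ t` tends to `0` as `t → ∞`. -/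
def IsTransient {n : Type*} [Fintype n] [DecidableEq n] (Q : Matrix n n ℝ) : Prop :=
  ∀ i j, Filter.Tendsto (fun t : ℕ => (Q ^ t) i j) Filter.atTop (nhds 0)

/-- A square matrix is substochastic if its entries are nonnegative and each row sums to `1`
or less. -/
def IsSubstochastic {n : Type*} [Fintype n] (Q : Matrix n n ℝ) : Prop :=
  (∀ i j, 0 ≤ Q i j) ∧ ∀ i, ∑ j, Q i j ≤ 1

/-- A multi-state prescribes a state for each bandit. -/
abbrev MultiState {K : ℕ} (N : Fin K → Type*) := ∀ k, N k

/-- A stationary nonrandomized (deterministic) policy picks, for each multi-state, a bandit. -/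
abbrev Policy {K : ℕ} (N : Fin K → Type*) := MultiState N → Fin K

/-- A labeling assigns to each state of each bandit (`some ⟨k, i⟩`) and to the termination
state (`none`) a label between `1` and `|N| + 1`, where `|N|` is the total number of states,
such that no two labels are equal and the termination state has the highest label. -/
structure Labeling {K : ℕ} (N : Fin K → Type*) [∀ k, Fintype (N k)] where
  label : Option (Σ k, N k) → ℕ
  label_mem : ∀ j, label j ∈ Set.Icc 1 (Fintype.card (Σ k, N k) + 1)
  label_none : label none = Fintype.card (Σ k, N k) + 1
  label_injective : Function.Injective label

/-- The policy `π` is keyed to the labeling `L`: in each multi-state `s`, it plays the bandit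
whose current state has the lowest label. -/
def IsKeyedTo {K : ℕ} {N : Fin K → Type*} [∀ k, Fintype (N k)]
    (π : Policy N) (L : Labeling N) : Prop :=
  ∀ (s : MultiState N) (k : Fin K), L.label (some ⟨π s, s (π s)⟩) ≤ L.label (some ⟨k, s k⟩)

/-- A priority rule is a policy that is keyed to some labeling. -/
def IsPriorityRule {K : ℕ} {N : Fin K → Type*} [∀ k, Fintype (N k)] (π : Policy N) : Prop :=
  ∃ L : Labeling N, IsKeyedTo π L

section

variable {K W : ℕ} {N : Fin K → Type*} [∀ k, Fintype (N k)] [∀ k, DecidableEq (N k)]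

/-- Hypothesis RN: each transition rate matrix is nonnegative and transient, and is
substochastic. -/
def MultiArmedBandit.HypothesisRN (B : MultiArmedBandit K W N) : Prop :=
  ∀ k, (∀ i j, 0 ≤ B.q k i j) ∧ IsTransient (B.q k) ∧ IsSubstochastic (B.q k)

/-- The transition rate matrix of a policy on the multi-states: playing bandit `δ s` in
multi-state `s` changes only the state of that bandit. -/
def MultiArmedBandit.transitionMatrix (B : MultiArmedBandit K W N) (δ : Policy N) :
    Matrix (MultiState N) (MultiState N) ℝ :=
  Matrix.of fun s t =>
    if t = Function.update s (δ s) (t (δ s)) then B.q (δ s) (s (δ s)) (t (δ s)) else 0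

/-- The type-`w` reward vector of a policy. -/
def MultiArmedBandit.rewardVector (B : MultiArmedBandit K W N) (w : Fin (W + 1))
    (δ : Policy N) : MultiState N → ℝ :=
  fun s => B.r w (δ s) (s (δ s))

/-- The vector of expected total type-`w` utilities of a policy, `(I - Q)⁻¹ R`. (If each `B.q k`
is nonnegative and transient then `Q` is transient, and so `I - Q` is invertible.) -/
noncomputable def MultiArmedBandit.value (B : MultiArmedBandit K W N) (w : Fin (W + 1))
    (δ : Policy N) : MultiState N → ℝ :=
  Matrix.mulVec (1 - B.transitionMatrix δ)⁻¹ (B.rewardVector w δ)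

/-- The feasible solutions of the linear program whose decision variables are the weights
`α δ` of the policies `δ` in `D` (the values of `α` outside `D` play no role): the weights are
nonnegative, sum to `1`, and the expected type-`w` reward from the initial multi-state `s` is at
least the bound on it, for each of the types `w = 1, …, W`. The bound on type `w.succ` is
`C w`. -/
def MultiArmedBandit.feasibleSet (B : MultiArmedBandit K W N) (C : Fin W → ℝ)
    (s : MultiState N) (D : Finset (Policy N)) : Set (Policy N → ℝ) :=
  {α | ∑ δ ∈ D, α δ = 1 ∧
    (∀ w : Fin W, C w ≤ ∑ δ ∈ D, α δ * B.value w.succ δ s) ∧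
    ∀ δ ∈ D, 0 ≤ α δ}

/-- Program 1 (one variable per stationary deterministic policy) is feasible. -/
def MultiArmedBandit.Program1Feasible (B : MultiArmedBandit K W N) (C : Fin W → ℝ)
    (s : MultiState N) : Prop :=
  (B.feasibleSet C s Finset.univ).Nonempty

open Classical in
/-- Program 2 (one variable per priority rule) is feasible. -/
def MultiArmedBandit.Program2Feasible (B : MultiArmedBandit K W N) (C : Fin W → ℝ)
    (s : MultiState N) : Prop :=
  (B.feasibleSet C s (Finset.univ.filter fun π : Policy N => IsPriorityRule π)).Nonempty

end

end ConstrainedBandit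

/-!
A mixture of priority rules meeting the bounds `C` is found by separation. If there were none, the
compact convex set of reward vectors attained by mixtures of priority rules would be strictly
separated from the orthant `{z | C ≤ z}` (`exists_mem_stdSimplex_le_sum`), so some nonnegative
weights `c` would make the scalar reward `∑ w, c w * r w` of every priority rule fall short of
`∑ w, c w * C w`. But for a single type of reward some priority rule is at least as good as every
policy (`exists_priorityRule_value_ge`), hence as good as the given solution of Program 1.

For one type of reward the optimality of a priority rule is proved with an explicit solution of the
optimality equation. Suppose first that all row sums are less than `1`. For a set `A` of states let
`h` be the probability that a bandit, played until its state is in `A`, gets there. The product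
`∏ k, h (s k)` is preserved by playing a state outside `A`, and playing a state `i` of `A` lowers
it in expectation by `1 - ∑ j, q i j * h j` times the product of the values of `h` at the other
bandits. That last factor is at most `1`, and is `1` if all bandits are in `A`, as they are when
a rule that prefers the complement of `A` plays a state of `A`. A greedy choice of a decreasing
chain of sets `A`, each obtained from the previous one by removing the state that maximizes the
ratio of the remaining reward to the decrement, writes the reward as a combination of these
decrements. All coefficients but that of the first set, for which the product is constant, are
nonpositive, so the corresponding combination `V` of the products dominates every policy and is
attained by the rule that follows the chain (`exists_greedy_potential`).

The general case follows by replacing `q` with `(1 - ε) • q` and letting `ε` tend to `0`: there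
are finitely many policies, and their values are continuous in `ε` because `1 - Q` is invertible.
-/

namespace ConstrainedBandit

open Matrix Filter Topology

/-! ### Nonnegative matrices that contract a positive vector -/

section Contracting

variable {n : Type*} [Fintype n]

/-- A minimum principle: `1 - Q` has a nonnegative inverse, in the sense that
`(1 - Q) v ≥ 0` forces `v ≥ 0`, when `Q` is nonnegative and strictly decreases some positive
vector `u`. -/
theorem nonneg_of_mulVec_le {Q : Matrix n n ℝ} (hQ : ∀ i j, 0 ≤ Q i j) {u : n → ℝ}
    (hu : ∀ i, 0 < u i) (hQu : ∀ i, (Q *ᵥ u) i < u i) {v : n → ℝ}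
    (hv : ∀ i, (Q *ᵥ v) i ≤ v i) (i : n) : 0 ≤ v i := by
  by_contra! hi
  have : Nonempty n := ⟨i⟩
  obtain ⟨m, hm⟩ := Finite.exists_min fun j => v j / u j
  set c := v m / u m with hc
  have hc0 : c < 0 := (hm i).trans_lt (div_neg_of_neg_of_pos hi (hu i))
  have hcm : c * u m = v m := div_mul_cancel₀ _ (hu m).ne'
  have h1 : c * (Q *ᵥ u) m ≤ (Q *ᵥ v) m := by
    simp only [mulVec, dotProduct, Finset.mul_sum]
    refine Finset.sum_le_sum fun j _ => ?_
    have : c * u j ≤ v j := (le_div_iff₀ (hu j)).1 (hm j)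
    nlinarith [mul_le_mul_of_nonneg_left this (hQ m j)]
  have h2 : c * u m < c * (Q *ᵥ u) m := mul_lt_mul_of_neg_left (hQu m) hc0
  linarith [hv m]

theorem isUnit_one_sub [DecidableEq n] {Q : Matrix n n ℝ} (hQ : ∀ i j, 0 ≤ Q i j) {u : n → ℝ}
    (hu : ∀ i, 0 < u i) (hQu : ∀ i, (Q *ᵥ u) i < u i) : IsUnit (1 - Q) := by
  rw [← mulVec_injective_iff_isUnit]
  intro x y hxy
  simp only [sub_mulVec, one_mulVec] at hxy
  have key : ∀ i, x i - (Q *ᵥ x) i = y i - (Q *ᵥ y) i := fun i => congrFun hxy i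
  have h1 := nonneg_of_mulVec_le hQ hu hQu (v := x - y) fun i => by
    simp only [mulVec_sub, Pi.sub_apply]; linarith [key i]
  have h2 := nonneg_of_mulVec_le hQ hu hQu (v := y - x) fun i => by
    simp only [mulVec_sub, Pi.sub_apply]; linarith [key i]
  funext i
  have := h1 i
  have := h2 i
  simp only [Pi.sub_apply] at *
  linarith

/-- The probability `h i` that a chain with transition matrix `q`, started from `i`, reaches `A`
before it terminates. -/
theorem exists_hitting_prob [DecidableEq n] {q : Matrix n n ℝ} (hq : ∀ i j, 0 ≤ q i j)
    (hlt : ∀ i, ∑ j, q i j < 1) (A : Set n) :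
    ∃ h : n → ℝ, (∀ i, 0 ≤ h i) ∧ (∀ i, h i ≤ 1) ∧ (∀ i ∈ A, h i = 1) ∧
      ∀ i ∉ A, ∑ j, q i j * h j = h i := by
  classical
  set M : Matrix n n ℝ := Matrix.of fun i j => if i ∈ A then 0 else q i j with hM
  have hMu (f : n → ℝ) (i : n) : (M *ᵥ f) i = if i ∈ A then 0 else ∑ j, q i j * f j := by
    by_cases hi : i ∈ A <;> simp [hM, mulVec, dotProduct, hi]
  have hM0 : ∀ i j, 0 ≤ M i j := fun i j => by
    by_cases hi : i ∈ A <;> simp [hM, hi, hq]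
  have hM1 : ∀ i, (M *ᵥ 1) i < (1 : n → ℝ) i := fun i => by
    rw [hMu]
    by_cases hi : i ∈ A <;> simp [hi, hlt]
  have hunit : IsUnit (1 - M) := isUnit_one_sub hM0 (fun _ => one_pos) hM1
  set b : n → ℝ := fun i => if i ∈ A then 1 else 0 with hb
  obtain ⟨h, hh⟩ := (mulVec_surjective_iff_isUnit.2 hunit) b
  have heq (i : n) : h i = (M *ᵥ h) i + b i := by
    have := congrFun hh i
    simp only [sub_mulVec, one_mulVec, Pi.sub_apply] at this
    linarith
  have hb0 (i : n) : 0 ≤ b i := by simp only [hb]; split_ifs <;> norm_num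
  refine ⟨h, ?_, ?_, ?_, ?_⟩
  · exact nonneg_of_mulVec_le hM0 (fun _ => one_pos) hM1 fun i => by linarith [heq i, hb0 i]
  · intro i
    have := nonneg_of_mulVec_le hM0 (u := 1) (fun _ => one_pos) hM1 (v := 1 - h) (fun i => by
      have h1 := hM1 i
      have h2 := heq i
      simp only [mulVec_sub, Pi.sub_apply, Pi.one_apply] at h1 ⊢
      by_cases hi : i ∈ A
      · have h3 : (M *ᵥ 1) i = 0 := by simp [hMu, hi]
        have h4 : b i = 1 := by simp [hb, hi]
        linarith
      · have h4 : b i = 0 := by simp [hb, hi]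
        linarith) i
    simpa using this
  · intro i hi
    simpa [hMu, hi, hb] using heq i
  · intro i hi
    simpa [hMu, hi, hb] using (heq i).symm

/-- The expected number of the first `T` steps that the chain survives, with `T` so large that
less than half of the mass survives `T` steps, drops by at least `1 / 2` in each step. -/
theorem IsTransient.exists_potential [DecidableEq n] {q : Matrix n n ℝ} (hq : ∀ i j, 0 ≤ q i j)
    (ht : IsTransient q) :
    ∃ u : n → ℝ, (∀ i, 0 ≤ u i) ∧ ∀ i, ∑ j, q i j * u j ≤ u i - 1 / 2 := by
  have hpow (t : ℕ) : ∀ i j, 0 ≤ (q ^ t) i j := by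
    induction t with
    | zero => intro i j; rw [pow_zero, one_apply]; split_ifs <;> norm_num
    | succ t ih =>
      intro i j
      rw [pow_succ, mul_apply]
      exact Finset.sum_nonneg fun k _ => mul_nonneg (ih i k) (hq k j)
  have htend (i : n) : Tendsto (fun t : ℕ => ∑ j, (q ^ t) i j) atTop (𝓝 0) := by
    simpa using tendsto_finsetSum Finset.univ fun j _ => ht i j
  obtain ⟨T, hT⟩ := (eventually_all.2 fun i =>
    (htend i).eventually (gt_mem_nhds (by norm_num : (0 : ℝ) < 1 / 2))).exists
  have hsum (t : ℕ) (i : n) : ((q ^ t) *ᵥ 1) i = ∑ j, (q ^ t) i j := by simp [mulVec, dotProduct]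
  refine ⟨fun i => ∑ t ∈ Finset.range T, ((q ^ t) *ᵥ 1) i, fun i => ?_, fun i => ?_⟩
  · exact Finset.sum_nonneg fun t _ => by
      rw [hsum]; exact Finset.sum_nonneg fun j _ => hpow t i j
  · have h1 : ∑ j, q i j * ∑ t ∈ Finset.range T, ((q ^ t) *ᵥ 1) j =
        ∑ t ∈ Finset.range T, ((q ^ (t + 1)) *ᵥ 1) i := by
      simp only [Finset.mul_sum, pow_succ', ← mulVec_mulVec]
      rw [Finset.sum_comm]
      rfl
    have h2 := Finset.sum_range_succ' (fun t => ((q ^ t) *ᵥ (1 : n → ℝ)) i) T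
    rw [Finset.sum_range_succ] at h2
    have h3 : ((q ^ 0) *ᵥ (1 : n → ℝ)) i = 1 := by simp
    have h4 := hT i
    rw [← hsum] at h4
    rw [h1]
    linarith

end Contracting

/-! ### Playing one bandit -/

section Play

variable {K : ℕ} {N : Fin K → Type*} [∀ k, Fintype (N k)]

/-- The expected value of `f` at the next multi-state when bandit `k` is played in multi-state `s`,
with `f` counted as `0` upon termination. -/
def expectedNext (q : ∀ k, Matrix (N k) (N k) ℝ) (f : MultiState N → ℝ) (s : MultiState N)
    (k : Fin K) : ℝ :=
  ∑ j, q k (s k) j * f (Function.update s k j)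

theorem expectedNext_add (q : ∀ k, Matrix (N k) (N k) ℝ) (f g : MultiState N → ℝ)
    (s : MultiState N) (k : Fin K) :
    expectedNext q (fun t => f t + g t) s k = expectedNext q f s k + expectedNext q g s k := by
  simp only [expectedNext, mul_add, Finset.sum_add_distrib]

theorem expectedNext_const_mul (q : ∀ k, Matrix (N k) (N k) ℝ) (c : ℝ) (f : MultiState N → ℝ)
    (s : MultiState N) (k : Fin K) :
    expectedNext q (fun t => c * f t) s k = c * expectedNext q f s k := by
  simp only [expectedNext, Finset.mul_sum]
  exact Finset.sum_congr rfl fun j _ => by ring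

theorem expectedNext_prod (q : ∀ k, Matrix (N k) (N k) ℝ) (h : ∀ k, N k → ℝ)
    (s : MultiState N) (k : Fin K) :
    expectedNext q (fun t => ∏ l, h l (t l)) s k =
      (∑ j, q k (s k) j * h k j) * ∏ l ∈ Finset.univ.erase k, h l (s l) := by
  rw [expectedNext, Finset.sum_mul]
  refine Finset.sum_congr rfl fun j _ => ?_
  rw [← Finset.mul_prod_erase _ _ (Finset.mem_univ k), Function.update_self, mul_assoc]
  congr 2
  refine Finset.prod_congr rfl fun l hl => ?_
  rw [Function.update_of_ne (Finset.ne_of_mem_erase hl)]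

theorem expectedNext_sum (q : ∀ k, Matrix (N k) (N k) ℝ) (u : ∀ k, N k → ℝ)
    (s : MultiState N) (k : Fin K) :
    expectedNext q (fun t => ∑ l, u l (t l)) s k =
      ∑ j, q k (s k) j * u k j + (∑ j, q k (s k) j) * ∑ l ∈ Finset.univ.erase k, u l (s l) := by
  rw [expectedNext, Finset.sum_mul, ← Finset.sum_add_distrib]
  refine Finset.sum_congr rfl fun j _ => ?_
  rw [← Finset.add_sum_erase _ _ (Finset.mem_univ k), Function.update_self, mul_add]
  congr 2
  refine Finset.sum_congr rfl fun l hl => ?_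
  rw [Function.update_of_ne (Finset.ne_of_mem_erase hl)]

variable [∀ k, DecidableEq (N k)]

theorem transitionMatrix_mulVec {W : ℕ} (B : MultiArmedBandit K W N) (δ : Policy N)
    (f : MultiState N → ℝ) (s : MultiState N) :
    (B.transitionMatrix δ *ᵥ f) s = expectedNext B.q f s (δ s) := by
  symm
  refine Fintype.sum_of_injective (fun j => Function.update s (δ s) j)
    (Function.update_injective s (δ s)) _ _ (fun t ht => ?_) fun j => ?_
  · have : t ≠ Function.update s (δ s) (t (δ s)) := fun h => ht ⟨_, h.symm⟩
    simp [MultiArmedBandit.transitionMatrix, this]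
  · simp [MultiArmedBandit.transitionMatrix]

omit [∀ k, Fintype (N k)] in
theorem transitionMatrix_nonneg {W : ℕ} (B : MultiArmedBandit K W N)
    (hq : ∀ k i j, 0 ≤ B.q k i j) (δ : Policy N) (s t : MultiState N) :
    0 ≤ B.transitionMatrix δ s t := by
  simp only [MultiArmedBandit.transitionMatrix, of_apply]
  split_ifs
  exacts [hq _ _ _, le_rfl]

/-- The sum over the bandits of their expected truncated lifetimes is a positive vector that
every policy strictly decreases. -/
theorem MultiArmedBandit.HypothesisRN.exists_potential {W : ℕ} {B : MultiArmedBandit K W N}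
    (hB : B.HypothesisRN) (δ : Policy N) :
    ∃ U : MultiState N → ℝ, (∀ s, 0 < U s) ∧ ∀ s, (B.transitionMatrix δ *ᵥ U) s < U s := by
  choose u hu0 hu using fun k => (hB k).2.1.exists_potential (hB k).1
  have hrest (s : MultiState N) (k : Fin K) : 0 ≤ ∑ l ∈ Finset.univ.erase k, u l (s l) :=
    Finset.sum_nonneg fun l _ => hu0 l _
  refine ⟨fun s => ∑ l, u l (s l), fun s => ?_, fun s => ?_⟩
  · have h1 : 0 ≤ ∑ j, B.q (δ s) (s (δ s)) j * u (δ s) j :=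
      Finset.sum_nonneg fun j _ => mul_nonneg ((hB _).1 _ _) (hu0 _ _)
    beta_reduce
    rw [← Finset.add_sum_erase _ _ (Finset.mem_univ (δ s))]
    linarith [hu (δ s) (s (δ s)), hrest s (δ s)]
  · beta_reduce
    rw [transitionMatrix_mulVec, expectedNext_sum,
      ← Finset.add_sum_erase _ _ (Finset.mem_univ (δ s))]
    have := mul_le_of_le_one_left (hrest s (δ s)) ((hB (δ s)).2.2.2 (s (δ s)))
    linarith [hu (δ s) (s (δ s))]

end Play

/-! ### The greedy potential -/

section Greedy

variable {K : ℕ} {N : Fin K → Type*} [∀ k, Fintype (N k)] [∀ k, DecidableEq (N k)]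

/-- A reward `ρ` that vanishes outside `A` and is nonpositive on `A` has a potential `V` that
solves the optimality equation: playing any bandit loses at least the reward, and nothing more is
lost by playing a state outside `A` or, if all bandits are in `A`, by playing the state that comes
first in the order given by `ℓ`. -/
theorem exists_greedy_potential {q : ∀ k, Matrix (N k) (N k) ℝ} (hq : ∀ k i j, 0 ≤ q k i j)
    (hlt : ∀ k i, ∑ j, q k i j < 1) (A : Finset (Σ k, N k)) (ρ : (Σ k, N k) → ℝ)
    (hρA : ∀ x ∈ A, ρ x ≤ 0) (hρ0 : ∀ x ∉ A, ρ x = 0) :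
    ∃ (ℓ : (Σ k, N k) → ℕ) (V : MultiState N → ℝ), Set.InjOn ℓ A ∧ (∀ x ∈ A, ℓ x < A.card) ∧
      ∀ s k, ρ ⟨k, s k⟩ + expectedNext q V s k ≤ V s ∧
        ((⟨k, s k⟩ ∉ A ∨ ∀ l, ⟨l, s l⟩ ∈ A ∧ ℓ ⟨k, s k⟩ ≤ ℓ ⟨l, s l⟩) →
          V s = ρ ⟨k, s k⟩ + expectedNext q V s k) := by
  induction hn : A.card generalizing A ρ with
  | zero =>
    rw [Finset.card_eq_zero] at hn
    subst hn
    exact ⟨fun _ => 0, fun _ => 0, by simp, by simp, by simp [expectedNext, hρ0]⟩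
  | succ n ih =>
    choose h h0 h1 hA hAc using fun k => exists_hitting_prob (hq k) (hlt k) {i | ⟨k, i⟩ ∈ A}
    set a : (Σ k, N k) → ℝ := fun x => 1 - ∑ j, q x.1 x.2 j * h x.1 j with ha
    have ha0 (x) : 0 < a x := by
      have : ∑ j, q x.1 x.2 j * h x.1 j ≤ ∑ j, q x.1 x.2 j :=
        Finset.sum_le_sum fun j _ => mul_le_of_le_one_right (hq _ _ _) (h1 _ _)
      simp only [ha]
      linarith [hlt x.1 x.2]
    obtain ⟨x₀, hx₀, hmax⟩ := A.exists_max_image (fun x => ρ x / a x)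
      (Finset.card_pos.1 (by omega))
    set y := ρ x₀ / a x₀ with hy
    have hy0 : y ≤ 0 := div_nonpos_of_nonpos_of_nonneg (hρA _ hx₀) (ha0 _).le
    set ρ' : (Σ k, N k) → ℝ := fun x => if x ∈ A then ρ x - y * a x else 0 with hρ'
    have hρ'A : ∀ x ∈ A.erase x₀, ρ' x ≤ 0 := fun x hx => by
      have hxA := Finset.mem_of_mem_erase hx
      simp only [hρ', hxA, if_true]
      linarith [(div_le_iff₀ (ha0 x)).1 (hmax x hxA)]
    have hρ'0 : ∀ x ∉ A.erase x₀, ρ' x = 0 := fun x hx => by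
      by_cases hxA : x ∈ A
      · have : x = x₀ := by by_contra hne; exact hx (Finset.mem_erase.2 ⟨hne, hxA⟩)
        subst this
        simp [hρ', hxA, hy, div_mul_cancel₀ _ (ha0 x).ne']
      · simp [hρ', hxA]
    have hcard : (A.erase x₀).card = n := by rw [Finset.card_erase_of_mem hx₀, hn]; rfl
    obtain ⟨ℓ, V, hinj, hℓ, hV⟩ := ih (A.erase x₀) ρ' hρ'A hρ'0 hcard
    -- The product of the hitting probabilities drops by `a` times the product over the others.
    have hH (s : MultiState N) (k : Fin K) :
        ∏ l, h l (s l) - expectedNext q (fun t => ∏ l, h l (t l)) s k =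
          if (⟨k, s k⟩ : Σ k, N k) ∈ A then
            a ⟨k, s k⟩ * ∏ l ∈ Finset.univ.erase k, h l (s l) else 0 := by
      rw [expectedNext_prod, ← Finset.mul_prod_erase _ _ (Finset.mem_univ k), ← sub_mul]
      split_ifs with hk
      · rw [hA k (s k) hk]
      · rw [hAc k (s k) hk, sub_self, zero_mul]
    refine ⟨fun x => if x = x₀ then 0 else ℓ x + 1, fun s => V s + y * ∏ l, h l (s l),
      ?_, ?_, fun s k => ?_⟩
    · intro x hx z hz hxz
      simp only at hxz
      split_ifs at hxz with h1 h2 h2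
      · rw [h1, h2]
      · exact hinj (Finset.mem_erase.2 ⟨h1, hx⟩) (Finset.mem_erase.2 ⟨h2, hz⟩) (by omega)
    · intro x hx
      simp only
      split_ifs with h1
      · omega
      · have := hℓ x (Finset.mem_erase.2 ⟨h1, hx⟩)
        omega
    · rw [expectedNext_add, expectedNext_const_mul]
      obtain ⟨hle, heq⟩ := hV s k
      have hHk := hH s k
      by_cases hk : (⟨k, s k⟩ : Σ k, N k) ∈ A
      · rw [if_pos hk] at hHk
        have hρk : ρ ⟨k, s k⟩ = ρ' ⟨k, s k⟩ + y * a ⟨k, s k⟩ := by simp [hρ', hk]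
        have hP1 : ∏ l ∈ Finset.univ.erase k, h l (s l) ≤ 1 :=
          Finset.prod_le_one (fun l _ => h0 l _) fun l _ => h1 l _
        refine ⟨?_, ?_⟩
        · have := mul_le_mul_of_nonpos_left (mul_le_of_le_one_right (ha0 ⟨k, s k⟩).le hP1) hy0
          rw [← hHk] at this
          linarith
        · rintro (hk' | hmin)
          · exact absurd hk hk'
          · have hP : ∏ l ∈ Finset.univ.erase k, h l (s l) = 1 :=
              Finset.prod_eq_one fun l _ => hA l (s l) (hmin l).1
            rw [hP, mul_one] at hHk
            have hVk := heq (by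
              by_cases hkx : (⟨k, s k⟩ : Σ k, N k) = x₀
              · left; simp [hkx]
              · right
                intro l
                obtain ⟨hlA, hle⟩ := hmin l
                simp only [hkx, if_false] at hle
                split_ifs at hle with hlx
                · omega
                · exact ⟨Finset.mem_erase.2 ⟨hlx, hlA⟩, by omega⟩)
            simp only
            rw [hVk, hρk, ← hHk]
            ring
      · rw [if_neg hk] at hHk
        have hρk : ρ ⟨k, s k⟩ = ρ' ⟨k, s k⟩ := by simp [hρ', hk, hρ0]
        have hVk := heq (Or.inl fun hc => hk (Finset.mem_of_mem_erase hc))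
        have : V s + y * ∏ l, h l (s l) = ρ ⟨k, s k⟩ + (expectedNext q V s k +
            y * expectedNext q (fun t => ∏ l, h l (t l)) s k) := by
          rw [hρk, hVk, sub_eq_zero.1 hHk]
          ring
        exact ⟨this.ge, fun _ => this⟩

end Greedy

/-! ### Optimality of priority rules for one type of reward -/

section Optimality

variable {K : ℕ} {N : Fin K → Type*} [∀ k, Fintype (N k)] [∀ k, DecidableEq (N k)]

/-- The labeling whose labels are those of `ℓ`, shifted to start from `1`. -/
def labelingOfInjective (ℓ : (Σ k, N k) → ℕ) (hinj : Function.Injective ℓ)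
    (hℓ : ∀ x, ℓ x < Fintype.card (Σ k, N k)) : Labeling N where
  label x := x.elim (Fintype.card (Σ k, N k) + 1) fun x => ℓ x + 1
  label_mem x := by
    cases x with
    | none => simp
    | some x => exact ⟨Nat.le_add_left 1 _, Nat.succ_le_succ (hℓ x).le⟩
  label_none := rfl
  label_injective := by
    rintro (_ | x) (_ | z) hxz
    · rfl
    · have := hℓ z
      simp only [Option.elim] at hxz
      omega
    · have := hℓ x
      simp only [Option.elim] at hxz
      omega
    · simp only [Option.elim] at hxz
      rw [hinj (by omega : ℓ x = ℓ z)]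

theorem value_eq_add {W : ℕ} {B : MultiArmedBandit K W N} {δ : Policy N}
    (hunit : IsUnit (1 - B.transitionMatrix δ)) (w : Fin (W + 1)) (s : MultiState N) :
    B.value w δ s = B.r w (δ s) (s (δ s)) + (B.transitionMatrix δ *ᵥ B.value w δ) s := by
  have h1 : (1 - B.transitionMatrix δ) *ᵥ B.value w δ = B.rewardVector w δ := by
    rw [MultiArmedBandit.value, mulVec_mulVec,
      mul_nonsing_inv _ ((isUnit_iff_isUnit_det _).1 hunit), one_mulVec]
  have h2 := congrFun h1 s
  simp only [sub_mulVec, one_mulVec, Pi.sub_apply, MultiArmedBandit.rewardVector] at h2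
  linarith

/-- The case of row sums less than `1`: a single priority rule is optimal from all multi-states. -/
theorem exists_priorityRule_value_ge_of_sum_lt_one [Nonempty (Fin K)]
    (B : MultiArmedBandit K 0 N) (hq : ∀ k i j, 0 ≤ B.q k i j)
    (hlt : ∀ k i, ∑ j, B.q k i j < 1) :
    ∃ π : Policy N, IsPriorityRule π ∧ ∀ δ s, B.value 0 δ s ≤ B.value 0 π s := by
  have hQ1 (δ : Policy N) (s : MultiState N) :
      (B.transitionMatrix δ *ᵥ 1) s < (1 : MultiState N → ℝ) s := by
    rw [transitionMatrix_mulVec]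
    simpa [expectedNext] using hlt (δ s) (s (δ s))
  have hQ0 := transitionMatrix_nonneg B hq
  have hunit (δ : Policy N) : IsUnit (1 - B.transitionMatrix δ) :=
    isUnit_one_sub (hQ0 δ) (fun _ => one_pos) (hQ1 δ)
  set d : (Σ k, N k) → ℝ := fun x => 1 - ∑ j, B.q x.1 x.2 j with hd
  have hd0 (x) : 0 < d x := sub_pos.2 (hlt _ _)
  -- Subtracting `y * d` from the reward changes all values by the constant `y`, and makes the
  -- reward nonpositive for large `y`.
  obtain ⟨y, hy⟩ := (Set.finite_range fun x : Σ k, N k => B.r 0 x.1 x.2 / d x).bddAbove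
  have hy (x : Σ k, N k) : B.r 0 x.1 x.2 - y * d x ≤ 0 := by
    linarith [(div_le_iff₀ (hd0 x)).1 (hy ⟨x, rfl⟩)]
  obtain ⟨ℓ, V, hinj, hℓ, hV⟩ := exists_greedy_potential hq hlt Finset.univ
    (fun x => B.r 0 x.1 x.2 - y * d x) (fun x _ => hy x) (by simp)
  choose π hπ using fun s : MultiState N => Finite.exists_min fun k => ℓ ⟨k, s k⟩
  refine ⟨π, ⟨labelingOfInjective ℓ (fun x z => hinj (by simp) (by simp))
    (fun x => hℓ x (by simp)), fun s k => Nat.succ_le_succ (hπ s k)⟩, fun δ s => ?_⟩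
  have hnext (s : MultiState N) (k : Fin K) : expectedNext B.q (fun t => V t + y) s k =
      expectedNext B.q V s k + y * (1 - d ⟨k, s k⟩) := by
    rw [expectedNext_add]
    simp [expectedNext, hd, Finset.mul_sum, mul_comm]
  have hle (δ : Policy N) (s : MultiState N) :
      B.r 0 (δ s) (s (δ s)) + (B.transitionMatrix δ *ᵥ fun t => V t + y) s ≤ V s + y := by
    rw [transitionMatrix_mulVec, hnext]
    linarith [(hV s (δ s)).1]
  have heq (s : MultiState N) :
      B.r 0 (π s) (s (π s)) + (B.transitionMatrix π *ᵥ fun t => V t + y) s = V s + y := by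
    rw [transitionMatrix_mulVec, hnext]
    linarith [(hV s (π s)).2 (Or.inr fun l => ⟨by simp, hπ s l⟩)]
  have h1 := nonneg_of_mulVec_le (hQ0 δ) (fun _ => one_pos) (hQ1 δ)
    (v := (fun t => V t + y) - B.value 0 δ) (fun s => by
      simp only [mulVec_sub, Pi.sub_apply]
      linarith [hle δ s, value_eq_add (hunit δ) 0 s]) s
  have h2 := nonneg_of_mulVec_le (hQ0 π) (fun _ => one_pos) (hQ1 π)
    (v := B.value 0 π - fun t => V t + y) (fun s => by
      simp only [mulVec_sub, Pi.sub_apply]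
      linarith [heq s, value_eq_add (hunit π) 0 s]) s
  simp only [Pi.sub_apply] at h1 h2
  linarith

/-- The bandit in which, additionally, each play terminates with probability `ε`. -/
def MultiArmedBandit.discount {W : ℕ} (B : MultiArmedBandit K W N) (ε : ℝ) :
    MultiArmedBandit K W N where
  q k := (1 - ε) • B.q k
  r := B.r

omit [∀ k, Fintype (N k)] in
theorem transitionMatrix_discount {W : ℕ} (B : MultiArmedBandit K W N) (ε : ℝ) (δ : Policy N) :
    (B.discount ε).transitionMatrix δ = (1 - ε) • B.transitionMatrix δ := by
  ext s t
  simp [MultiArmedBandit.transitionMatrix, MultiArmedBandit.discount]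

theorem MultiArmedBandit.HypothesisRN.isUnit {W : ℕ} {B : MultiArmedBandit K W N}
    (hB : B.HypothesisRN) (δ : Policy N) : IsUnit (1 - B.transitionMatrix δ) := by
  obtain ⟨U, hU, hQU⟩ := hB.exists_potential δ
  exact isUnit_one_sub (transitionMatrix_nonneg B (fun k => (hB k).1) δ) hU hQU

theorem tendsto_value_discount {W : ℕ} {B : MultiArmedBandit K W N} (hB : B.HypothesisRN)
    (w : Fin (W + 1)) (δ : Policy N) (s : MultiState N) :
    Tendsto (fun ε => (B.discount ε).value w δ s) (𝓝[>] 0) (𝓝 (B.value w δ s)) := by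
  have hcont : Continuous fun ε : ℝ => 1 - (B.discount ε).transitionMatrix δ := by
    simp only [transitionMatrix_discount]
    fun_prop
  have h0 : 1 - (B.discount 0).transitionMatrix δ = 1 - B.transitionMatrix δ := by
    simp [transitionMatrix_discount]
  have hdet : (1 - (B.discount 0).transitionMatrix δ).det ≠ 0 := by
    rw [h0]
    exact ((isUnit_iff_isUnit_det _).1 (hB.isUnit δ)).ne_zero
  have hval (ε : ℝ) : (B.discount ε).value w δ s =
      (1 - (B.discount ε).transitionMatrix δ).det⁻¹ *
        ((1 - (B.discount ε).transitionMatrix δ).adjugate *ᵥ B.rewardVector w δ) s := by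
    rw [MultiArmedBandit.value, inv_def, Ring.inverse_eq_inv', smul_mulVec]
    rfl
  have hzero : (B.discount 0).value w δ s = B.value w δ s := by
    rw [MultiArmedBandit.value, h0]
    rfl
  rw [← hzero]
  refine Tendsto.mono_left ?_ nhdsWithin_le_nhds
  simp only [hval]
  have h1 : Continuous fun ε : ℝ =>
      ((1 - (B.discount ε).transitionMatrix δ).adjugate *ᵥ B.rewardVector w δ) s :=
    (continuous_apply s).comp (hcont.matrix_adjugate.matrix_mulVec continuous_const)
  exact (hcont.matrix_det.continuousAt.inv₀ hdet).mul h1.continuousAt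

/-- For one type of reward, some priority rule is at least as good as every policy. -/
theorem exists_priorityRule_value_ge [Nonempty (Fin K)] {B : MultiArmedBandit K 0 N}
    (hB : B.HypothesisRN) (s : MultiState N) :
    ∃ π : Policy N, IsPriorityRule π ∧ ∀ δ, B.value 0 δ s ≤ B.value 0 π s := by
  -- If each priority rule were beaten by some policy, then each would still be beaten for all
  -- small `ε`, as there are finitely many of them.
  by_contra! hcon
  have hev : ∀ᶠ ε in 𝓝[>] (0 : ℝ), ∀ π : Policy N, IsPriorityRule π →
      ∃ δ, (B.discount ε).value 0 π s < (B.discount ε).value 0 δ s := by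
    refine eventually_all.2 fun π => ?_
    by_cases hπ : IsPriorityRule π
    · obtain ⟨δ, hδ⟩ := hcon π hπ
      filter_upwards [(tendsto_value_discount hB 0 π s).eventually_lt
        (tendsto_value_discount hB 0 δ s) hδ] with ε hε _
      exact ⟨δ, hε⟩
    · exact Eventually.of_forall fun _ h => absurd h hπ
  obtain ⟨ε, hε, hε0, hε1⟩ := (hev.and (Ioo_mem_nhdsGT one_pos)).exists
  obtain ⟨π, hπ, hopt⟩ := exists_priorityRule_value_ge_of_sum_lt_one (B.discount ε)
    (fun k i j => mul_nonneg (sub_nonneg.2 hε1.le) ((hB k).1 i j)) fun k i => by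
      have h1 := (hB k).2.2.2 i
      have h2 : ∑ j, (B.discount ε).q k i j = (1 - ε) * ∑ j, B.q k i j := by
        simp [MultiArmedBandit.discount, Finset.mul_sum]
      rw [h2]
      nlinarith
  obtain ⟨δ, hδ⟩ := hε π hπ
  exact absurd (hopt δ s) (not_le.2 hδ)

end Optimality

/-! ### Separation -/

/-- If every nonnegative weighting of the coordinates makes some `v i` at least as good as `C`,
then a mixture of the `v i` dominates `C`. -/
theorem exists_mem_stdSimplex_le_sum {ι κ : Type*} [Fintype ι] [Fintype κ] (v : ι → κ → ℝ)
    (C : κ → ℝ)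
    (h : ∀ c : κ → ℝ, (∀ w, 0 ≤ c w) → ∃ i, ∑ w, c w * C w ≤ ∑ w, c w * v i w) :
    ∃ α ∈ stdSimplex ℝ ι, ∀ w, C w ≤ ∑ i, α i * v i w := by
  classical
  by_contra! hcon
  have hdisj : Disjoint (Fintype.linearCombination ℝ v '' stdSimplex ℝ ι) (Set.Ici C) := by
    rw [Set.disjoint_left]
    rintro _ ⟨α, hα, rfl⟩ hC
    obtain ⟨w, hw⟩ := hcon α hα
    have := hC w
    simp only [Fintype.linearCombination_apply, Finset.sum_apply, Pi.smul_apply,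
      smul_eq_mul] at this
    linarith
  obtain ⟨f, a, b, hfa, hab, hfb⟩ := geometric_hahn_banach_compact_closed
    ((convex_stdSimplex ℝ ι).linear_image _)
    ((isCompact_stdSimplex ℝ ι).image (LinearMap.continuous_on_pi _))
    (convex_Ici C) isClosed_Ici hdisj
  have hf (x : κ → ℝ) : f x = ∑ w, f (Pi.single w 1) * x w := by
    conv_lhs => rw [← Finset.univ_sum_single x, map_sum]
    refine Finset.sum_congr rfl fun w _ => ?_
    have : Pi.single w (x w) = x w • (Pi.single w 1 : κ → ℝ) := by
      rw [← Pi.single_smul, smul_eq_mul, mul_one]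
    rw [this, map_smul, smul_eq_mul, mul_comm]
  -- `f` is bounded below on the orthant above `C`, so its coefficients are nonnegative.
  have hc (w : κ) : 0 ≤ f (Pi.single w 1) := by
    by_contra! hneg
    have h1 := hfb C (le_refl C)
    have ht : 0 ≤ (b - f C) / f (Pi.single w 1) :=
      div_nonneg_of_nonpos (by linarith) hneg.le
    have h2 := hfb (C + ((b - f C) / f (Pi.single w 1)) • Pi.single w 1)
      (Set.mem_Ici.2 (le_add_of_nonneg_right (smul_nonneg ht (Pi.single_nonneg.2 zero_le_one))))
    rw [map_add, map_smul, smul_eq_mul, div_mul_cancel₀ _ hneg.ne] at h2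
    linarith
  obtain ⟨i, hi⟩ := h (fun w => f (Pi.single w 1)) hc
  rw [← hf, ← hf] at hi
  have h1 := hfa (v i) ⟨Pi.single i 1, single_mem_stdSimplex ℝ i, by
    simp [Fintype.linearCombination_apply_single]⟩
  linarith [hfb C (le_refl C)]

end ConstrainedBandit

open ConstrainedBandit Matrix in
theorem proposition7p1 {K W : ℕ} {N : Fin K → Type*} [∀ k, Fintype (N k)]
    [∀ k, DecidableEq (N k)] (B : ConstrainedBandit.MultiArmedBandit K W N)
    (hB : B.HypothesisRN) (C : Fin W → ℝ) (s : ConstrainedBandit.MultiState N)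
    (h : B.Program1Feasible C s) : B.Program2Feasible C s := by
  classical
  obtain ⟨α, hα1, hαC, hα0⟩ := h
  -- With no bandits there are no policies, and Program 1 is infeasible.
  have hK : Nonempty (Fin K) := by
    by_contra hK
    have : IsEmpty (Policy N) := ⟨fun δ => hK ⟨δ s⟩⟩
    simp at hα1
  obtain ⟨β, ⟨hβ0, hβ1⟩, hβC⟩ := exists_mem_stdSimplex_le_sum
    (fun (π : {π : Policy N // IsPriorityRule π}) w => B.value w.succ π.1 s) C (fun c hc => by
      set B' : MultiArmedBandit K 0 N := ⟨B.q, fun _ k i => ∑ w, c w * B.r (Fin.succ w) k i⟩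
      have hval (δ : Policy N) : ∑ w, c w * B.value (Fin.succ w) δ s = B'.value 0 δ s := by
        have h1 : B'.rewardVector 0 δ = ∑ w, c w • B.rewardVector (Fin.succ w) δ := by
          funext t
          simp [B', MultiArmedBandit.rewardVector]
        have h2 : B'.value 0 δ =
            (1 - B.transitionMatrix δ)⁻¹ *ᵥ ∑ w, c w • B.rewardVector (Fin.succ w) δ := by
          rw [← h1]
          rfl
        rw [h2]
        simp only [mulVec_sum, mulVec_smul, Finset.sum_apply, Pi.smul_apply, smul_eq_mul,
          MultiArmedBandit.value]
      obtain ⟨π, hπ, hopt⟩ := exists_priorityRule_value_ge (B := B') hB s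
      refine ⟨⟨π, hπ⟩, ?_⟩
      calc ∑ w, c w * C w ≤ ∑ w, c w * ∑ δ, α δ * B.value w.succ δ s :=
            Finset.sum_le_sum fun w _ => mul_le_mul_of_nonneg_left (hαC w) (hc w)
        _ = ∑ δ, α δ * B'.value 0 δ s := by
            simp only [← hval, Finset.mul_sum]
            rw [Finset.sum_comm]
            exact Finset.sum_congr rfl fun δ _ => Finset.sum_congr rfl fun w _ => by ring
        _ ≤ ∑ δ, α δ * B'.value 0 π s :=
            Finset.sum_le_sum fun δ hδ => mul_le_mul_of_nonneg_left (hopt δ) (hα0 δ hδ)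
        _ = ∑ w, c w * B.value w.succ π s := by rw [← Finset.sum_mul, hα1, one_mul, hval])
  have hsum (g : Policy N → ℝ) :
      ∑ π ∈ Finset.univ.filter fun π : Policy N => IsPriorityRule π,
        (if hπ : IsPriorityRule π then β ⟨π, hπ⟩ else 0) * g π = ∑ π, β π * g π := by
    rw [Finset.sum_subtype (p := fun π : Policy N => IsPriorityRule π) _ (by simp)]
    exact Finset.sum_congr rfl fun π _ => by rw [dif_pos π.2]
  refine ⟨fun π => if hπ : IsPriorityRule π then β ⟨π, hπ⟩ else 0, ?_, fun w => ?_, fun π hπ => ?_⟩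
  · simpa [hβ1] using hsum 1
  · exact (hβC w).trans_eq (hsum fun π => B.value w.succ π s).symm
  · simp only [dif_pos (Finset.mem_filter.1 hπ).2]
    exact hβ0 _
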